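/- **Theorem 2.** Consider a convex operational probabilistic theory. Every system $A$ has finitely many fiducial measurements $j$, each with finitely many outcomes $i$, and a state of $A$ is a list $\vec P=(P(i|j))$ of probabilities, normalised for every $j$. The allowed states form a closed convex set $\mathcal S_A$. A state of a composite system $AB$ is a non-signalling list $P(ii'|jj')$ of the joint probabilities of the fiducial measurements of $A$ and $B$; its marginals, its conditional states given an outcome of a fiducial measurement on one part, and all products $\vec P_A\otimes\vec P_B$ of allowed states are allowed states. The theory contains, for every $d\in\mathbb N$, a classical system with one fiducial measurement with $d$ outcomes, whose states are all probability distributions; for $d=1$ it is the vacuum $V$, and $\vec P_A\otimes \vec 1_V$ is identified with $\vec P_A$. The allowed transformations are linear maps that take states to states. They are closed under composition and under local application ($T\mapsto \mathrm{id}\otimes T$), and they include the identity maps, reordering and regrouping the parts of a composite system, removing a system (taking the marginal), adding an independent system ($\vec P_A\mapsto\vec P_A\otimes\vec P_B$), performing a fiducial measurement and recording its outcome in a classical system, and performing a transformation chosen according to the value of a classical system. A measurement with $d$ outcomes is an allowed transformation into the $d$-outcome classical system. Let $H$ be an entropy measure: a real number $H(A)$ for every state of every system $A$, depending neither on the order nor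 on the grouping of the parts of a composite system and with $H(AV)=H(A)$, together with a real number $H(A|B)$ for every state of every bipartite system $AB$. Suppose that * (COND) $H(A|B)=H(AB)-H(B)$ for every allowed state of $AB$; * (SHAN) $H$ is the Shannon entropy (in bits) on classical systems and their composites; * (DPI) $H(A|B)_{\vec P_{AB}}\le H(A|B')_{(\mathrm{id}\otimes T)\vec P_{AB}}$ for every allowed state $\vec P_{AB}$ and every allowed transformation $T$ from $B$ to $B'$. Then the following hold. 1. (Information causality) Let Alice and Bob share any allowed state of a bipartite system $AB$. Alice receives $N$ independent unbiased bits $\vec a=(a_0,\dots,a_{N-1})$ and, by an allowed transformation of $A$ that may depend on $\vec a$, prepares a classical $m$-bit message, which she sends to Bob. Bob receives $b\in\{0,\dots,N-1\}$ and, by an allowed transformation of the message and $B$ that may depend on $b$, produces a bit $\beta$. Then $\sum_{i} I_{\mathrm{Sh}}(a_i:\beta\,|\,b=i)\le m$, where $I_{\mathrm{Sh}}$ is the Shannon mutual information in bits. 2. (Tsirelson's bound) For every allowed state of a bipartite system $AB$ and any two two-outcome measurements on each of $A$ and $B$, with joint outcome probabilities $p(a,b|x,y)$, the quantity $S=p(a=b|00)+p(a=b|01)+p(a=b|10)+p(a\ne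 b|11)$ satisfies $2-\sqrt2\le S\le 2+\sqrt2$. -/

import Mathlib

universe u

namespace GPT

/-- The elementary (non-classical) kinds of systems of a theory. A system of kind `e` is of type
`(k e, l e)`: it has `k e` fiducial measurements, each with `l e` outcomes. -/
structure Signature where
  Elem : Type u
  k : Elem → ℕ
  l : Elem → ℕ
  k_pos : ∀ e, 0 < k e

/-- Systems: classical systems of type `(1, d)`, elementary systems, and composites of two systems.
-/
inductive Sys (σ : Signature.{u}) : Type u
  | classical (d : ℕ) : Sys σ
  | elem (e : σ.Elem) : Sys σ
  | comp (A B : Sys σ) : Sys σ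

namespace Sys

variable {σ : Signature.{u}}

/-- The vacuum: the trivial classical system, of type `(1, 1)`. -/
abbrev vac : Sys σ := classical 1

/-- Labels of the fiducial measurements of a system. On a composite system they are the pairs of
fiducial measurements of the two parts, performed simultaneously. -/
@[reducible] def Meas : Sys σ → Type
  | classical _ => Unit
  | elem e => Fin (σ.k e)
  | comp A B => Meas A × Meas B

/-- Labels of the outcomes of each fiducial measurement of a system. -/
@[reducible] def Out : Sys σ → Type
  | classical d => Fin d
  | elem e => Fin (σ.l e)
  | comp A B => Out A × Out B

instance instFintypeOut : (A : Sys σ) → Fintype (Out A)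
  | classical d => inferInstanceAs (Fintype (Fin d))
  | elem e => inferInstanceAs (Fintype (Fin (σ.l e)))
  | comp A B =>
    letI := instFintypeOut A
    letI := instFintypeOut B
    inferInstanceAs (Fintype (Out A × Out B))

/-- The first fiducial measurement of a system. -/
def meas0 : (A : Sys σ) → Meas A
  | classical _ => ()
  | elem e => ⟨0, σ.k_pos e⟩
  | comp A B => (meas0 A, meas0 B)

/-- Systems composed of classical systems only. -/
def IsClassical : Sys σ → Prop
  | classical _ => True
  | elem _ => False
  | comp A B => IsClassical A ∧ IsClassical B

/-- Vectors of a system: `P j i` stands for `P(i|j)`, the weight of the outcome `i` of the fiducial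
measurement `j`. On `comp A B` the entry `P (j, j') (i, i')` stands for `P(i i'|j j')`. -/
abbrev Vec (A : Sys σ) : Type := Meas A → Out A → ℝ

end Sys

open Sys

section Maps

variable {σ : Signature.{u}}

/-- The product vector `P ⊗ Q`. -/
def prodVec {A B : Sys σ} (P : Vec A) (Q : Vec B) : Vec (comp A B) :=
  fun j i => P j.1 i.1 * Q j.2 i.2

/-- The vector of a composite system with the label `j'` of the fiducial measurement and the
outcome `i'` of the second part held fixed: `P(· i'|· j')`. -/
def sliceFst {A B : Sys σ} (P : Vec (comp A B)) (j' : Meas B) (i' : Out B) : Vec A :=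
  fun j i => P (j, j') (i, i')

/-- The vector of a composite system with the label `j` of the fiducial measurement and the
outcome `i` of the first part held fixed: `P(i ·|j ·)`. -/
def sliceSnd {A B : Sys σ} (P : Vec (comp A B)) (j : Meas A) (i : Out A) : Vec B :=
  fun j' i' => P (j, j') (i, i')

/-- Removing the second system: the marginal `P_A(i|j) = ∑ i', P(i i'|j j')`. The fiducial
measurement `j'` on the removed system is fixed here; for non-signalling vectors the marginal does
not depend on it. -/
def removeSnd (A B : Sys σ) : Vec (comp A B) →ₗ[ℝ] Vec A where
  toFun P := fun j i => ∑ i' : Out B, P (j, meas0 B) (i, i')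
  map_add' P Q := by
    funext j i
    simp [Finset.sum_add_distrib]
  map_smul' c P := by
    funext j i
    simp [Finset.mul_sum]

/-- Removing the first system: the marginal on the second one. -/
def removeFst (A B : Sys σ) : Vec (comp A B) →ₗ[ℝ] Vec B where
  toFun P := fun j' i' => ∑ i : Out A, P (meas0 A, j') (i, i')
  map_add' P Q := by
    funext j i
    simp [Finset.sum_add_distrib]
  map_smul' c P := by
    funext j i
    simp [Finset.mul_sum]

/-- Adding an independent system with vector `Q`: the map `P ↦ P ⊗ Q`. -/
def addSys (A : Sys σ) {B : Sys σ} (Q : Vec B) : Vec A →ₗ[ℝ] Vec (comp A B) where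
  toFun P := prodVec P Q
  map_add' P P' := by
    funext j i
    simp [prodVec, add_mul]
  map_smul' c P := by
    funext j i
    simp [prodVec, mul_assoc]

/-- Interchanging the two parts of a composite system. -/
def swap (A B : Sys σ) : Vec (comp A B) →ₗ[ℝ] Vec (comp B A) where
  toFun P := fun j i => P (j.2, j.1) (i.2, i.1)
  map_add' _ _ := rfl
  map_smul' _ _ := rfl

/-- Regrouping the parts of a tripartite system, from `(AB)C` to `A(BC)`. -/
def assoc (A B C : Sys σ) : Vec (comp (comp A B) C) →ₗ[ℝ] Vec (comp A (comp B C)) where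
  toFun P := fun j i => P ((j.1, j.2.1), j.2.2) ((i.1, i.2.1), i.2.2)
  map_add' _ _ := rfl
  map_smul' _ _ := rfl

/-- The local map `𝟙 ⊗ T` on a composite system. -/
def onSnd (C : Sys σ) {A B : Sys σ} (T : Vec A →ₗ[ℝ] Vec B) :
    Vec (comp C A) →ₗ[ℝ] Vec (comp C B) where
  toFun P := fun j i => T (sliceSnd P j.1 i.1) j.2 i.2
  map_add' P Q := by
    funext j i
    have h : sliceSnd (P + Q) j.1 i.1 = sliceSnd P j.1 i.1 + sliceSnd Q j.1 i.1 := rfl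
    simp [h]
  map_smul' c P := by
    funext j i
    have h : sliceSnd (c • P) j.1 i.1 = c • sliceSnd P j.1 i.1 := rfl
    simp [h]

/-- The local map `T ⊗ 𝟙` on a composite system. -/
def onFst {A B : Sys σ} (T : Vec A →ₗ[ℝ] Vec B) (C : Sys σ) :
    Vec (comp A C) →ₗ[ℝ] Vec (comp B C) where
  toFun P := fun j i => T (sliceFst P j.2 i.2) j.1 i.1
  map_add' P Q := by
    funext j i
    have h : sliceFst (P + Q) j.2 i.2 = sliceFst P j.2 i.2 + sliceFst Q j.2 i.2 := rfl
    simp [h]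
  map_smul' c P := by
    funext j i
    have h : sliceFst (c • P) j.2 i.2 = c • sliceFst P j.2 i.2 := rfl
    simp [h]

/-- Performing the fiducial measurement `j` on an elementary system and recording its outcome in a
classical system. -/
def fiducial (e : σ.Elem) (j : Fin (σ.k e)) :
    Vec (elem e : Sys σ) →ₗ[ℝ] Vec (classical (σ.l e) : Sys σ) where
  toFun P := fun _ i => P j i
  map_add' _ _ := rfl
  map_smul' _ _ := rfl

/-- Performing the map `T x` on a system conditioned on the value `x` of a classical system, which
is kept. -/
def control {d : ℕ} {A B : Sys σ} (T : Fin d → (Vec A →ₗ[ℝ] Vec B)) :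
    Vec (comp (classical d) A) →ₗ[ℝ] Vec (comp (classical d) B) where
  toFun P := fun j i => T i.1 (sliceSnd P () i.1) j.2 i.2
  map_add' P Q := by
    funext j i
    have h : sliceSnd (P + Q) () i.1 = sliceSnd P () i.1 + sliceSnd Q () i.1 := rfl
    simp [h]
  map_smul' c P := by
    funext j i
    have h : sliceSnd (c • P) () i.1 = c • sliceSnd P () i.1 := rfl
    simp [h]

end Maps

/-- A convex operational probabilistic theory with the elementary systems of `σ`. -/
structure Theory (σ : Signature.{u}) where
  /-- The allowed normalised states of each system. -/
  states : (A : Sys σ) → Set (Vec A)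
  /-- The allowed (deterministic) transformations of each system into each system. -/
  trans : (A B : Sys σ) → Set (Vec A →ₗ[ℝ] Vec B)
  nonneg : ∀ {A : Sys σ} {P : Vec A}, P ∈ states A → ∀ j i, 0 ≤ P j i
  normalised : ∀ {A : Sys σ} {P : Vec A}, P ∈ states A → ∀ j, ∑ i, P j i = 1
  isClosed_states : ∀ A : Sys σ, IsClosed (states A)
  convex_states : ∀ A : Sys σ, Convex ℝ (states A)
  /-- The states of a classical system are all the probability distributions. -/
  classical_states : ∀ (d : ℕ) (P : Vec (classical d : Sys σ)),
    (∀ i, 0 ≤ P () i) → ∑ i : Fin d, P () i = 1 → P ∈ states (classical d)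
  /-- No signalling: the marginal on the first system does not depend on the fiducial measurement
  performed on the second one. -/
  noSignalling : ∀ {A B : Sys σ} {P : Vec (comp A B)}, P ∈ states (comp A B) →
    ∀ (j : Meas A) (i : Out A) (j₁ j₂ : Meas B),
      ∑ i' : Out B, P (j, j₁) (i, i') = ∑ i' : Out B, P (j, j₂) (i, i')
  /-- The conditional marginal `P(i i'|j j') / P_B(i'|j')` is a state of the first system whenever
  the outcome `i'` of the fiducial measurement `j'` on the second one has non-zero probability. -/
  conditional_mem : ∀ {A B : Sys σ} {P : Vec (comp A B)}, P ∈ states (comp A B) →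
    ∀ (j' : Meas B) (i' : Out B), removeFst A B P j' i' ≠ 0 →
      (removeFst A B P j' i')⁻¹ • sliceFst P j' i' ∈ states A
  prod_mem : ∀ {A B : Sys σ} {P : Vec A} {Q : Vec B}, P ∈ states A → Q ∈ states B →
    prodVec P Q ∈ states (comp A B)
  /-- Transformations take states to states. -/
  map_mem : ∀ {A B : Sys σ} {T : Vec A →ₗ[ℝ] Vec B}, T ∈ trans A B →
    ∀ {P : Vec A}, P ∈ states A → T P ∈ states B
  id_mem : ∀ A : Sys σ, LinearMap.id ∈ trans A A
  comp_mem : ∀ {A B C : Sys σ} {T : Vec A →ₗ[ℝ] Vec B} {U : Vec B →ₗ[ℝ] Vec C},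
    T ∈ trans A B → U ∈ trans B C → U ∘ₗ T ∈ trans A C
  /-- Transformations may be performed locally, on part of a composite system. -/
  onSnd_mem : ∀ (C : Sys σ) {A B : Sys σ} {T : Vec A →ₗ[ℝ] Vec B}, T ∈ trans A B →
    onSnd C T ∈ trans (comp C A) (comp C B)
  /-- The order and the grouping of the parts of a composite system are immaterial. -/
  swap_mem : ∀ A B : Sys σ, swap A B ∈ trans (comp A B) (comp B A)
  assoc_mem : ∀ A B C : Sys σ, assoc A B C ∈ trans (comp (comp A B) C) (comp A (comp B C))
  /-- Systems may be removed. -/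
  remove_mem : ∀ A B : Sys σ, removeSnd A B ∈ trans (comp A B) A
  /-- Systems may be added. -/
  add_mem : ∀ (A : Sys σ) {B : Sys σ} {Q : Vec B}, Q ∈ states B → addSys A Q ∈ trans A (comp A B)
  /-- Fiducial measurements may be performed. -/
  fiducial_mem : ∀ (e : σ.Elem) (j : Fin (σ.k e)), fiducial e j ∈ trans (elem e) (classical (σ.l e))
  /-- The choice of the transformation may depend on classical data. With the possibility to add
  and to remove systems this includes the cloning and every other processing of classical
  systems. -/
  control_mem : ∀ {d : ℕ} {A B : Sys σ} {T : Fin d → (Vec A →ₗ[ℝ] Vec B)},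
    (∀ x, T x ∈ trans A B) → control T ∈ trans (comp (classical d) A) (comp (classical d) B)

/-- The Shannon entropy, in bits, of a distribution on a finite set. -/
noncomputable def shannon {ι : Type*} [Fintype ι] (p : ι → ℝ) : ℝ :=
  -∑ i, p i * Real.logb 2 (p i)

/-- The Shannon mutual information, in bits, of a joint distribution of two variables. -/
noncomputable def mutualInfo {ι κ : Type*} [Fintype ι] [Fintype κ] (q : ι → κ → ℝ) : ℝ :=
  shannon (fun s => ∑ t, q s t) + shannon (fun t => ∑ s, q s t)
    - shannon (fun st : ι × κ => q st.1 st.2)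

section Entropy

variable {σ : Signature.{u}}

/-- An operational entropy measure: an entropy `H(A)` for the states of every system, and a
conditional entropy `H(A|B)` for the states of every bipartite system. The entropy does not depend
on the order and on the grouping of the parts of a composite system, nor on the presence of the
vacuum, whose only state is `1`. -/
structure EntropyMeasure (𝒯 : Theory σ) where
  ent : (A : Sys σ) → Vec A → ℝ
  condEnt : (A B : Sys σ) → Vec (comp A B) → ℝ
  ent_swap : ∀ (A B : Sys σ) (P : Vec (comp A B)), P ∈ 𝒯.states (comp A B) →
    ent (comp B A) (swap A B P) = ent (comp A B) P
  ent_assoc : ∀ (A B C : Sys σ) (P : Vec (comp (comp A B) C)),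
    P ∈ 𝒯.states (comp (comp A B) C) →
      ent (comp A (comp B C)) (assoc A B C P) = ent (comp (comp A B) C) P
  ent_vac : ∀ (A : Sys σ) (P : Vec A), P ∈ 𝒯.states A →
    ent (comp A vac) (prodVec P (fun _ _ => 1 : Vec (vac : Sys σ))) = ent A P

variable {𝒯 : Theory σ}

/-- COND: `H(A|B) = H(AB) - H(B)`. -/
def EntropyMeasure.COND (H : EntropyMeasure 𝒯) : Prop :=
  ∀ (A B : Sys σ) (P : Vec (comp A B)), P ∈ 𝒯.states (comp A B) →
    H.condEnt A B P = H.ent (comp A B) P - H.ent B (removeFst A B P)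

/-- SHAN: on classical systems the entropy is the Shannon entropy. -/
def EntropyMeasure.SHAN (H : EntropyMeasure 𝒯) : Prop :=
  ∀ A : Sys σ, A.IsClassical → ∀ P : Vec A, P ∈ 𝒯.states A →
    H.ent A P = shannon (P (meas0 A))

/-- DPI: `H(A|B) ≤ H(A|B')` for every allowed local transformation `T` of `B` into `B'`. -/
def EntropyMeasure.DPI (H : EntropyMeasure 𝒯) : Prop :=
  ∀ (A B B' : Sys σ) (P : Vec (comp A B)) (T : Vec B →ₗ[ℝ] Vec B'),
    P ∈ 𝒯.states (comp A B) → T ∈ 𝒯.trans B B' →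
      H.condEnt A B P ≤ H.condEnt A B' (onSnd A T P)

end Entropy

section Games

variable {σ : Signature.{u}}

/-- The information causality game with `N` bits and an `m`-bit message. Alice and Bob share the
resource `P` on `AB`. Given her string `a`, Alice performs `E a` on `A` to prepare the message;
given `b` and the message, Bob performs `D b` on the message and `B` to make his guess `β`. This is
the probability that `β = t`, given `a` and `b`. -/
def guessProb {A B : Sys σ} {N m : ℕ} (P : Vec (comp A B))
    (E : (Fin N → Fin 2) → (Vec A →ₗ[ℝ] Vec (classical (2 ^ m) : Sys σ)))
    (D : Fin N → (Vec (comp (classical (2 ^ m)) B) →ₗ[ℝ] Vec (classical 2 : Sys σ)))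
    (a : Fin N → Fin 2) (b : Fin N) (t : Fin 2) : ℝ :=
  D b (onFst (E a) B P) () t

/-- The efficiency `I = ∑ i, I(a_i : β | b = i)` of a strategy in the information causality game,
where the bits of `a` are independent and unbiased. -/
noncomputable def efficiency {A B : Sys σ} {N m : ℕ} (P : Vec (comp A B))
    (E : (Fin N → Fin 2) → (Vec A →ₗ[ℝ] Vec (classical (2 ^ m) : Sys σ)))
    (D : Fin N → (Vec (comp (classical (2 ^ m)) B) →ₗ[ℝ] Vec (classical 2 : Sys σ))) : ℝ :=
  ∑ i : Fin N, mutualInfo fun s t : Fin 2 =>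
    ∑ a : Fin N → Fin 2, if a i = s then (2 ^ N : ℝ)⁻¹ * guessProb P E D a i t else 0

/-- Information causality: `I ≤ m` for every allowed resource and every allowed strategy. -/
def Theory.InformationCausality (𝒯 : Theory σ) : Prop :=
  ∀ (A B : Sys σ) (P : Vec (comp A B)) (N m : ℕ)
    (E : (Fin N → Fin 2) → (Vec A →ₗ[ℝ] Vec (classical (2 ^ m) : Sys σ)))
    (D : Fin N → (Vec (comp (classical (2 ^ m)) B) →ₗ[ℝ] Vec (classical 2 : Sys σ))),
    P ∈ 𝒯.states (comp A B) → (∀ a, E a ∈ 𝒯.trans A (classical (2 ^ m))) →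
      (∀ b, D b ∈ 𝒯.trans (comp (classical (2 ^ m)) B) (classical 2)) →
        efficiency P E D ≤ m

/-- The probability `p(a b|x y)` of the outcomes `a` and `b` when the measurements `M x` and `L y`
are performed on the two parts of a system. -/
def outcomeProb {A B : Sys σ} (P : Vec (comp A B))
    (M : Fin 2 → (Vec A →ₗ[ℝ] Vec (classical 2 : Sys σ)))
    (L : Fin 2 → (Vec B →ₗ[ℝ] Vec (classical 2 : Sys σ))) (x y a b : Fin 2) : ℝ :=
  onFst (M x) (classical 2) (onSnd A (L y) P) ((), ()) (a, b)

/-- The CHSH quantity `S = p(a=b|00) + p(a=b|01) + p(a=b|10) + p(a≠b|11)`. -/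
def chsh {A B : Sys σ} (P : Vec (comp A B))
    (M : Fin 2 → (Vec A →ₗ[ℝ] Vec (classical 2 : Sys σ)))
    (L : Fin 2 → (Vec B →ₗ[ℝ] Vec (classical 2 : Sys σ))) : ℝ :=
  let p := outcomeProb P M L
  (∑ a, p 0 0 a a) + (∑ a, p 0 1 a a) + (∑ a, p 1 0 a a) + (p 1 1 0 1 + p 1 1 1 0)

/-- Tsirelson's bound, for every allowed bipartite state and all allowed two-outcome
measurements. -/
def Theory.TsirelsonBound (𝒯 : Theory σ) : Prop :=
  ∀ (A B : Sys σ) (P : Vec (comp A B))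
    (M : Fin 2 → (Vec A →ₗ[ℝ] Vec (classical 2 : Sys σ)))
    (L : Fin 2 → (Vec B →ₗ[ℝ] Vec (classical 2 : Sys σ))),
    P ∈ 𝒯.states (comp A B) → (∀ x, M x ∈ 𝒯.trans A (classical 2)) →
      (∀ y, L y ∈ 𝒯.trans B (classical 2)) →
        2 - √2 ≤ chsh P M L ∧ chsh P M L ≤ 2 + √2

end Games

end GPT

/-! Write X for the message together with Bob's part B. Everything rests on DPI read through COND:
discarding a system gives subadditivity, preparing one from the vacuum gives superadditivity on
products, and removing bits gives H(a|X) ≤ ∑ H(a_i|X). Bob's guess is made from X, so I(a_i : β) ≤ 1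
- H(a_i|X), and the efficiency is at most N - H(aX) + H(X).

A message of d' values has H(X) ≤ log d' + H(B). By no-signalling the string a and B are in a
product state, of entropy at least N + H(B). If the message passed through a noisy classical
channel, each row of which has entropy at least c, then it adds at least c to the entropy of aB:
given the value before the noise, the value after it is independent of everything else. Altogether
the efficiency is at most log d' - c (`sum_mutualInfo_le`). The noiseless channel, with c = 0, is
information causality.

For Tsirelson's bound there are two bits and a one-bit message through a binary symmetric channel of
bias ε. The CHSH strategy gives Bob's guesses the biases ε E_0 and ε E_1, where S = 2 + E_0 + E_1.
To leading order the guesses carry at least ε² (E_0² + E_1²) / (2 ln 2) bits, while the channel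
allows ε² / (2 ln 2). Letting ε → 0 gives E_0² + E_1² ≤ 1, hence |E_0 + E_1| ≤ √2. Because the noise
enters the bound itself, one round of the game suffices and no concatenation of boxes is needed. -/

namespace GPT

open Sys

/-! ### Classical registers, products and derived maps -/

section Vectors

variable {σ : Signature.{u}}

/-- The point distribution at `x` on a classical system. -/
def delta {d : ℕ} (x : Fin d) : Vec (classical d : Sys σ) := fun _ i => if i = x then 1 else 0

/-- The state of the vacuum. -/
def vacState : Vec (vac : Sys σ) := fun _ _ => 1

/-- A register of `n` classical bits. -/
def bitReg : ℕ → Sys σ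
  | 0 => vac
  | n + 1 => comp (classical 2) (bitReg n)

/-- The deterministic state of a bit register. -/
def bitString : (n : ℕ) → (Fin n → Fin 2) → Vec (bitReg n : Sys σ)
  | 0, _ => vacState
  | n + 1, a => prodVec (delta (a 0)) (bitString n (Fin.tail a))

theorem isClassical_bitReg (n : ℕ) : (bitReg n : Sys σ).IsClassical := by
  induction n with
  | zero => exact trivial
  | succ n ih => exact ⟨trivial, ih⟩

theorem sum_out_comp {A B : Sys σ} (f : Out (comp A B) → ℝ) :
    ∑ i, f i = ∑ i : Out A, ∑ i' : Out B, f (i, i') :=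
  Fintype.sum_prod_type (fun x : Out A × Out B => f x)

theorem removeFst_prodVec {A B : Sys σ} {P : Vec A} (Q : Vec B) (hP : ∑ i, P (meas0 A) i = 1) :
    removeFst A B (prodVec P Q) = Q := by
  funext j i
  simp [removeFst, prodVec, ← Finset.sum_mul, hP]

theorem removeSnd_prodVec {A B : Sys σ} (P : Vec A) {Q : Vec B} (hQ : ∑ i, Q (meas0 B) i = 1) :
    removeSnd A B (prodVec P Q) = P := by
  funext j i
  simp [removeSnd, prodVec, ← Finset.mul_sum, hQ]

theorem onSnd_prodVec {A B B' : Sys σ} (T : Vec B →ₗ[ℝ] Vec B') (P : Vec A) (Q : Vec B) :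
    onSnd A T (prodVec P Q) = prodVec P (T Q) := by
  funext j i
  have h : sliceSnd (prodVec P Q) j.1 i.1 = P j.1 i.1 • Q := rfl
  simp [onSnd, h, prodVec]

theorem removeFst_eq_sum {A B : Sys σ} (P : Vec (comp A B)) :
    removeFst A B P = ∑ i, sliceSnd P (meas0 A) i := by
  funext j i
  simp [removeFst, sliceSnd]

theorem removeFst_onSnd {A B B' : Sys σ} (T : Vec B →ₗ[ℝ] Vec B') (P : Vec (comp A B)) :
    removeFst A B' (onSnd A T P) = T (removeFst A B P) := by
  rw [removeFst_eq_sum, removeFst_eq_sum, map_sum]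
  rfl

theorem sum_delta {d : ℕ} (x : Fin d) (j : Unit) : ∑ i, (delta x : Vec (classical d : Sys σ)) j i = 1 :=
  (Finset.sum_ite_eq' Finset.univ x fun _ => (1 : ℝ)).trans (by simp)

/-- Preparing the system `B` with vector `Q`. -/
def prepare {B : Sys σ} (Q : Vec B) : Vec (vac : Sys σ) →ₗ[ℝ] Vec B :=
  removeFst vac B ∘ₗ addSys vac Q

/-- Discarding a system. -/
def discard (A : Sys σ) : Vec A →ₗ[ℝ] Vec (vac : Sys σ) :=
  removeFst A vac ∘ₗ addSys A vacState

/-- Preparing the system `B` with a vector that depends on the value of a classical system. -/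
def condPrep {d : ℕ} {B : Sys σ} (Q : Fin d → Vec B) :
    Vec (classical d : Sys σ) →ₗ[ℝ] Vec B :=
  removeFst (classical d) B ∘ₗ control (fun x => prepare (Q x)) ∘ₗ addSys (classical d) vacState

theorem sum_out_vac (f : Out (vac : Sys σ) → ℝ) : ∑ i, f i = f (0 : Fin 1) :=
  Fin.sum_univ_one (fun i : Fin 1 => f i)

theorem prepare_vacState {B : Sys σ} (Q : Vec B) : prepare Q vacState = Q :=
  removeFst_prodVec (P := vacState) Q (sum_out_vac _)

/-- Branch `x` acts on the vacuum weighted by `P () x`, and removing the control register adds up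
the branches. -/
theorem condPrep_apply {d : ℕ} {B : Sys σ} (Q : Fin d → Vec B) (P : Vec (classical d : Sys σ)) :
    condPrep Q P = ∑ x, P () x • Q x := by
  have h (x : Fin d) : sliceSnd (prodVec P (vacState : Vec (vac : Sys σ))) () x
      = P () x • vacState := rfl
  calc condPrep Q P = ∑ x : Fin d, prepare (Q x)
        (sliceSnd (prodVec P (vacState : Vec (vac : Sys σ))) () x) := by
        funext j i
        rw [Finset.sum_apply, Finset.sum_apply]
        rfl
    _ = _ := Finset.sum_congr rfl fun x _ => by
        rw [h, map_smul]
        exact congrArg _ (prepare_vacState _)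

theorem condPrep_delta {d : ℕ} {B : Sys σ} (Q : Fin d → Vec B) (x : Fin d) :
    condPrep Q (delta x) = Q x := by
  rw [condPrep_apply]
  simp [delta]

/-- This makes the noiseless channel an instance of a noisy one. -/
theorem condPrep_delta_eq_id (d : ℕ) :
    condPrep (delta : Fin d → Vec (classical d : Sys σ)) = LinearMap.id := by
  refine LinearMap.ext fun P => ?_
  rw [condPrep_apply]
  funext j i
  simp [delta, Finset.sum_apply]

theorem onSnd_discard {A B : Sys σ} (P : Vec (comp A B)) :
    onSnd A (discard B) P = prodVec (removeSnd A B P) vacState := by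
  funext j i
  simp [onSnd, discard, removeFst, addSys, prodVec, vacState, removeSnd, sliceSnd]

theorem prodVec_sum_right {ι : Type*} (s : Finset ι) {A B : Sys σ} (P : Vec A) (Q : ι → Vec B) :
    prodVec P (∑ x ∈ s, Q x) = ∑ x ∈ s, prodVec P (Q x) := by
  funext j i
  simp [prodVec, Finset.sum_apply, Finset.mul_sum]

theorem assoc_prodVec {A B C : Sys σ} (P : Vec A) (Q : Vec B) (R : Vec C) :
    assoc A B C (prodVec (prodVec P Q) R) = prodVec P (prodVec Q R) := by
  funext j i
  simp [assoc, prodVec, mul_assoc]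

theorem swap_prodVec {A B : Sys σ} (P : Vec A) (Q : Vec B) :
    swap A B (prodVec P Q) = prodVec Q P := by
  funext j i
  simp [swap, prodVec, mul_comm]

/-- Exactly one string is compatible with a given outcome of the register. Hence the equal mixture
of all strings is the uniform distribution. -/
theorem sum_bitString (n : ℕ) (j : Meas (bitReg n : Sys σ)) (i : Out (bitReg n : Sys σ)) :
    ∑ a, bitString n a j i = 1 := by
  induction n with
  | zero => simp [bitString, vacState]
  | succ n ih =>
    rw [← (Fin.consEquiv fun _ => Fin 2).sum_comp, Fintype.sum_prod_type]
    have h (x : Fin 2) : ∑ y, bitString (n + 1) ((Fin.consEquiv fun _ => Fin 2) (x, y)) j i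
        = (delta x : Vec (classical 2 : Sys σ)) j.1 i.1 := by
      have h' (y : Fin n → Fin 2) : bitString (n + 1) ((Fin.consEquiv fun _ => Fin 2) (x, y)) j i
        = (delta x : Vec (classical 2 : Sys σ)) j.1 i.1 * bitString n y j.2 i.2 := rfl
      simp only [h', ← Finset.mul_sum, ih, mul_one]
    simp only [h]
    simp [delta]

theorem card_out_bitReg (n : ℕ) : Fintype.card (Out (bitReg n : Sys σ)) = 2 ^ n := by
  induction n with
  | zero => exact Fintype.card_fin 1
  | succ n ih =>
    have h : Fintype.card (Out (bitReg (n + 1) : Sys σ))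
      = Fintype.card (Fin 2 × Out (bitReg n : Sys σ)) := rfl
    rw [h, Fintype.card_prod, ih, Fintype.card_fin, pow_succ']

end Vectors

/-! ### Shannon entropy inequalities -/

section Shannon

variable {ι κ : Type*} [Fintype ι] [Fintype κ]

theorem shannon_le_logb_card {p : ι → ℝ} (h0 : ∀ i, 0 ≤ p i) (h1 : ∑ i, p i = 1) :
    shannon p ≤ Real.logb 2 (Fintype.card ι) := by
  have hne : Nonempty ι := by
    by_contra h
    rw [not_nonempty_iff] at h
    simp at h1
  have hn : (0 : ℝ) < Fintype.card ι := by exact_mod_cast Fintype.card_pos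
  have hl : 0 < Real.log 2 := Real.log_pos one_lt_two
  -- This is `1 - 1/x ≤ log x` at `x = n p_i`, multiplied by `p_i`. The left sides sum to zero.
  have key (i : ι) : p i - (Fintype.card ι : ℝ)⁻¹
      ≤ p i * (Real.log (p i) + Real.log (Fintype.card ι)) := by
    rcases (h0 i).eq_or_lt with h | h
    · rw [← h]; simp
    · rw [← Real.log_mul h.ne' hn.ne']
      have := Real.one_sub_inv_le_log_of_pos (mul_pos h hn)
      calc _ = p i * (1 - (p i * Fintype.card ι)⁻¹) := by field_simp
        _ ≤ _ := mul_le_mul_of_nonneg_left this h.le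
  have hs := Finset.sum_le_sum fun i (_ : i ∈ Finset.univ) => key i
  simp only [mul_add, Finset.sum_add_distrib, Finset.sum_sub_distrib, ← Finset.sum_mul, h1] at hs
  simp only [Finset.sum_const, Finset.card_univ, nsmul_eq_mul, mul_inv_cancel₀ hn.ne'] at hs
  unfold shannon Real.logb
  rw [← Finset.sum_neg_distrib, le_div_iff₀ hl, Finset.sum_mul]
  have : ∑ i, -(p i * (Real.log (p i) / Real.log 2)) * Real.log 2
      = - ∑ i, p i * Real.log (p i) := by
    rw [← Finset.sum_neg_distrib]
    exact Finset.sum_congr rfl fun i _ => by field_simp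
  rw [this]
  linarith

theorem shannon_const (n : ℕ) (h : Fintype.card ι = 2 ^ n) :
    shannon (fun _ : ι => ((2 : ℝ) ^ n)⁻¹) = n := by
  have : (2 : ℝ) ^ n ≠ 0 := by positivity
  simp [shannon, h, Real.logb_inv, Real.logb_pow]

/-- The chain rule for the Shannon entropy, as a lower bound. -/
theorem add_shannon_le_shannon_mul {p : κ → ℝ} {W : κ → ι → ℝ} {c : ℝ} (hp : ∀ y, 0 ≤ p y)
    (hp1 : ∑ y, p y = 1) (hW : ∀ y, ∑ z, W y z = 1) (hc : ∀ y, c ≤ shannon (W y)) :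
    c + shannon p ≤ shannon fun zy : ι × κ => p zy.2 * W zy.2 zy.1 := by
  have h (y : κ) (z : ι) : p y * W y z * Real.logb 2 (p y * W y z)
      = p y * Real.logb 2 (p y) * W y z + p y * (W y z * Real.logb 2 (W y z)) := by
    by_cases h1 : p y = 0
    · simp [h1]
    by_cases h2 : W y z = 0
    · simp [h2]
    rw [Real.logb_mul h1 h2]; ring
  have h2 : shannon (fun zy : ι × κ => p zy.2 * W zy.2 zy.1)
      = shannon p + ∑ y, p y * shannon (W y) := by
    unfold shannon
    rw [Fintype.sum_prod_type_right]
    simp only [h, Finset.sum_add_distrib, ← Finset.mul_sum, hW, mul_one, mul_neg,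
      Finset.sum_neg_distrib]
    ring
  have h3 : c ≤ ∑ y, p y * shannon (W y) := by
    calc c = ∑ y, p y * c := by rw [← Finset.sum_mul, hp1, one_mul]
      _ ≤ _ := Finset.sum_le_sum fun y _ => mul_le_mul_of_nonneg_left (hc y) (hp y)
  linarith

end Shannon

/-! ### Derived transformations, conditional states and no-signalling -/

namespace Theory

variable {σ : Signature.{u}} (𝒯 : Theory σ)

theorem delta_mem {d : ℕ} (x : Fin d) : delta x ∈ 𝒯.states (classical d) :=
  𝒯.classical_states d _ (fun i => by unfold delta; split_ifs <;> norm_num) (sum_delta x ())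

theorem vacState_mem : vacState ∈ 𝒯.states vac :=
  𝒯.classical_states 1 _ (fun _ => zero_le_one) (by simp [vacState])

theorem bitString_mem (n : ℕ) (a : Fin n → Fin 2) : bitString n a ∈ 𝒯.states (bitReg n) := by
  induction n with
  | zero => exact 𝒯.vacState_mem
  | succ n ih => exact 𝒯.prod_mem (𝒯.delta_mem _) (ih _)

theorem mix_mem {Ω : Type*} [Fintype Ω] {w : Ω → ℝ} (hw : ∀ ω, 0 ≤ w ω) (hw1 : ∑ ω, w ω = 1)
    {A : Sys σ} {P : Ω → Vec A} (hP : ∀ ω, P ω ∈ 𝒯.states A) : ∑ ω, w ω • P ω ∈ 𝒯.states A :=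
  (𝒯.convex_states A).sum_mem (fun ω _ => hw ω) hw1 fun ω _ => hP ω

theorem removeFst_mem (A B : Sys σ) : removeFst A B ∈ 𝒯.trans (comp A B) B :=
  𝒯.comp_mem (𝒯.swap_mem A B) (𝒯.remove_mem B A)

theorem onFst_mem {A B : Sys σ} {T : Vec A →ₗ[ℝ] Vec B} (hT : T ∈ 𝒯.trans A B) (C : Sys σ) :
    onFst T C ∈ 𝒯.trans (comp A C) (comp B C) :=
  𝒯.comp_mem (𝒯.swap_mem A C) (𝒯.comp_mem (𝒯.onSnd_mem C hT) (𝒯.swap_mem C B))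

theorem prepare_mem {B : Sys σ} {Q : Vec B} (hQ : Q ∈ 𝒯.states B) :
    prepare Q ∈ 𝒯.trans vac B :=
  𝒯.comp_mem (𝒯.add_mem _ hQ) (𝒯.removeFst_mem _ _)

theorem discard_mem (A : Sys σ) : discard A ∈ 𝒯.trans A vac :=
  𝒯.comp_mem (𝒯.add_mem _ 𝒯.vacState_mem) (𝒯.removeFst_mem _ _)

theorem condPrep_mem {d : ℕ} {B : Sys σ} {Q : Fin d → Vec B} (hQ : ∀ x, Q x ∈ 𝒯.states B) :
    condPrep Q ∈ 𝒯.trans (classical d) B :=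
  𝒯.comp_mem (𝒯.comp_mem (𝒯.add_mem _ 𝒯.vacState_mem)
    (𝒯.control_mem fun x => 𝒯.prepare_mem (hQ x))) (𝒯.removeFst_mem _ _)

variable {𝒯}

/-- For an outcome of probability zero the slice vanishes, and any state serves as witness; the
marginal is one. This removes the case distinction from later uses. -/
theorem exists_sliceFst_eq {A B : Sys σ} {P : Vec (comp A B)} (hP : P ∈ 𝒯.states (comp A B))
    (j' : Meas B) (i' : Out B) :
    ∃ Q ∈ 𝒯.states A, sliceFst P j' i' = removeFst A B P j' i' • Q := by
  by_cases h : removeFst A B P j' i' = 0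
  · refine ⟨removeSnd A B P, 𝒯.map_mem (𝒯.remove_mem A B) hP, ?_⟩
    rw [h, zero_smul]
    funext j i
    -- No-signalling from the first part to the second carries the zero from `meas0 A` to every `j`;
    -- non-negativity then kills each term.
    have h1 : ∑ i, P (j, j') (i, i') = 0 :=
      (𝒯.noSignalling (𝒯.map_mem (𝒯.swap_mem A B) hP) j' i' j (meas0 A)).trans h
    exact (Finset.sum_eq_zero_iff_of_nonneg fun i _ => 𝒯.nonneg hP _ _).1 h1 i (Finset.mem_univ _)
  · exact ⟨_, 𝒯.conditional_mem hP j' i' h, by rw [smul_smul, mul_inv_cancel₀ h, one_smul]⟩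

/-- A transformation of the first system does not change the marginal of the second one. -/
theorem removeFst_onFst {A A' B : Sys σ} {P : Vec (comp A B)} (hP : P ∈ 𝒯.states (comp A B))
    {T : Vec A →ₗ[ℝ] Vec A'} (hT : T ∈ 𝒯.trans A A') :
    removeFst A' B (onFst T B P) = removeFst A B P := by
  funext j' i'
  -- An allowed map is known to preserve normalisation only on states, so the slice has to be a
  -- multiple of one.
  obtain ⟨Q, hQ, h⟩ := exists_sliceFst_eq hP j' i'
  have h1 : removeFst A' B (onFst T B P) j' i' = ∑ i, T (sliceFst P j' i') (meas0 A') i := rfl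
  rw [h1, h, map_smul]
  simp [← Finset.mul_sum, 𝒯.normalised (𝒯.map_mem hT hQ)]

/-- A state of a system and a classical system is a mixture of products. -/
theorem exists_eq_sum_prodVec_delta {C : Sys σ} {d : ℕ} {P : Vec (comp C (classical d))}
    (hP : P ∈ 𝒯.states (comp C (classical d))) :
    ∃ (p : Fin d → ℝ) (Q : Fin d → Vec C), (∀ y, 0 ≤ p y) ∧ ∑ y, p y = 1 ∧
      (∀ y, Q y ∈ 𝒯.states C) ∧ P = ∑ y, p y • prodVec (Q y) (delta y) := by
  choose Q hQ h using fun y : Fin d => exists_sliceFst_eq hP () y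
  have hm := 𝒯.map_mem (𝒯.removeFst_mem _ _) hP
  refine ⟨removeFst C (classical d) P (), Q, 𝒯.nonneg hm (), 𝒯.normalised hm (), hQ, ?_⟩
  funext j i
  obtain ⟨j, ⟨⟩⟩ := j
  obtain ⟨i, y⟩ := i
  have := congrFun (congrFun (h y) j) i
  simp only [sliceFst, Pi.smul_apply, smul_eq_mul] at this
  simp [Finset.sum_apply, prodVec, delta, this]

end Theory

/-! ### Consequences of data processing for the entropy -/

namespace EntropyMeasure

variable {σ : Signature.{u}} {𝒯 : Theory σ} {H : EntropyMeasure 𝒯}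

/-- DPI with both sides expanded by COND; the local map carries the old marginal to the new one. -/
theorem ent_sub_le_of_trans (hC : H.COND) (hD : H.DPI) {A B B' : Sys σ} {P : Vec (comp A B)}
    (hP : P ∈ 𝒯.states (comp A B)) {T : Vec B →ₗ[ℝ] Vec B'} (hT : T ∈ 𝒯.trans B B') :
    H.ent (comp A B) P - H.ent B (removeFst A B P)
      ≤ H.ent (comp A B') (onSnd A T P) - H.ent B' (T (removeFst A B P)) := by
  rw [← hC A B P hP, ← removeFst_onSnd, ← hC A B' _ (𝒯.map_mem (𝒯.onSnd_mem A hT) hP)]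
  exact hD A B B' P T hP hT

theorem ent_vacState (hS : H.SHAN) : H.ent vac vacState = 0 := by
  rw [hS vac trivial _ 𝒯.vacState_mem]
  simp [shannon, vacState]

/-- Discarding `B` into the vacuum turns H(A|B) into H(A|V) = H(A). -/
theorem ent_le_add (hC : H.COND) (hS : H.SHAN) (hD : H.DPI) {A B : Sys σ} {P : Vec (comp A B)}
    (hP : P ∈ 𝒯.states (comp A B)) :
    H.ent (comp A B) P ≤ H.ent A (removeSnd A B P) + H.ent B (removeFst A B P) := by
  have h := ent_sub_le_of_trans hC hD hP (𝒯.discard_mem B)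
  have h1 : discard B (removeFst A B P) = vacState := by
    have := 𝒯.normalised (𝒯.map_mem (𝒯.removeFst_mem A B) hP) (meas0 B)
    exact removeFst_prodVec vacState this
  rw [h1, ent_vacState hS, onSnd_discard] at h
  have h2 := H.ent_vac A _ (𝒯.map_mem (𝒯.remove_mem A B) hP)
  change H.ent (comp A vac) (prodVec _ vacState) = _ at h2
  linarith

/-- The vacuum can be turned into `B` in the state `Q`, so H(A) = H(A|V) ≤ H(A|B). -/
theorem add_le_ent_prodVec (hC : H.COND) (hS : H.SHAN) (hD : H.DPI) {A B : Sys σ} {P : Vec A}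
    {Q : Vec B} (hP : P ∈ 𝒯.states A) (hQ : Q ∈ 𝒯.states B) :
    H.ent A P + H.ent B Q ≤ H.ent (comp A B) (prodVec P Q) := by
  have h := ent_sub_le_of_trans hC hD (𝒯.prod_mem hP 𝒯.vacState_mem) (𝒯.prepare_mem hQ)
  rw [removeFst_prodVec _ (𝒯.normalised hP _), onSnd_prodVec, prepare_vacState,
    ent_vacState hS] at h
  have h2 := H.ent_vac A _ hP
  change H.ent (comp A vac) (prodVec _ vacState) = _ at h2
  linarith

/-! ### Ensembles of product states -/

section Ensembles

variable {Ω : Type*} [Fintype Ω] {w : Ω → ℝ}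

theorem removeFst_mix {A B : Sys σ} {P : Ω → Vec A} (hP : ∀ ω, P ω ∈ 𝒯.states A) (Q : Ω → Vec B) :
    removeFst A B (∑ ω, w ω • prodVec (P ω) (Q ω)) = ∑ ω, w ω • Q ω := by
  rw [map_sum]
  refine Finset.sum_congr rfl fun ω _ => ?_
  rw [map_smul, removeFst_prodVec _ (𝒯.normalised (hP ω) _)]

theorem onSnd_mix {A B B' : Sys σ} (T : Vec B →ₗ[ℝ] Vec B') (P : Ω → Vec A) (Q : Ω → Vec B) :
    onSnd A T (∑ ω, w ω • prodVec (P ω) (Q ω)) = ∑ ω, w ω • prodVec (P ω) (T (Q ω)) := by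
  rw [map_sum]
  refine Finset.sum_congr rfl fun ω _ => ?_
  rw [map_smul, onSnd_prodVec]

theorem ent_mix_sub_le_of_trans (hC : H.COND) (hD : H.DPI) (hw : ∀ ω, 0 ≤ w ω)
    (hw1 : ∑ ω, w ω = 1) {A B B' : Sys σ} {P : Ω → Vec A} {Q : Ω → Vec B}
    (hP : ∀ ω, P ω ∈ 𝒯.states A) (hQ : ∀ ω, Q ω ∈ 𝒯.states B) {T : Vec B →ₗ[ℝ] Vec B'}
    (hT : T ∈ 𝒯.trans B B') :
    H.ent (comp A B) (∑ ω, w ω • prodVec (P ω) (Q ω)) - H.ent B (∑ ω, w ω • Q ω)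
      ≤ H.ent (comp A B') (∑ ω, w ω • prodVec (P ω) (T (Q ω)))
        - H.ent B' (∑ ω, w ω • T (Q ω)) := by
  have h := ent_sub_le_of_trans hC hD
    (𝒯.mix_mem hw hw1 fun ω => 𝒯.prod_mem (hP ω) (hQ ω)) hT
  rw [removeFst_mix hP, onSnd_mix, map_sum] at h
  simpa only [map_smul] using h

/-- The entropy of a string of bits, given any system, is at most the sum of the entropies of the
bits. -/
theorem ent_bitString_sub_le (hC : H.COND) (hD : H.DPI) (hw : ∀ ω, 0 ≤ w ω)
    (hw1 : ∑ ω, w ω = 1) {X : Sys σ} {Q : Ω → Vec X} (hQ : ∀ ω, Q ω ∈ 𝒯.states X) (n : ℕ)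
    (f : Ω → Fin n → Fin 2) :
    H.ent (comp (bitReg n) X) (∑ ω, w ω • prodVec (bitString n (f ω)) (Q ω))
        - H.ent X (∑ ω, w ω • Q ω)
      ≤ ∑ i, (H.ent (comp (classical 2) X) (∑ ω, w ω • prodVec (delta (f ω i)) (Q ω))
        - H.ent X (∑ ω, w ω • Q ω)) := by
  induction n with
  | zero =>
    have hm := 𝒯.mix_mem hw hw1 hQ
    have h : ∑ ω, w ω • prodVec (bitString 0 (f ω)) (Q ω)
        = swap X vac (prodVec (∑ ω, w ω • Q ω) vacState) := by
      rw [swap_prodVec, prodVec_sum_right]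
      refine Finset.sum_congr rfl fun ω _ => ?_
      funext j i
      simp [bitString, prodVec, mul_left_comm]
    have h1 := H.ent_vac X _ hm
    change H.ent (comp X vac) (prodVec _ vacState) = _ at h1
    have h2 := H.ent_swap X vac _ (𝒯.prod_mem hm 𝒯.vacState_mem)
    rw [h, Fin.sum_univ_zero]
    change H.ent (comp vac X) _ - _ ≤ _
    linarith
  | succ n ih =>
    let S (ω : Ω) : Vec (comp (classical 2) (bitReg n) : Sys σ) :=
      prodVec (delta (f ω 0)) (bitString n (Fin.tail (f ω)))
    have h1 := H.ent_assoc (classical 2) (bitReg n) X (∑ ω, w ω • prodVec (S ω) (Q ω))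
      (𝒯.mix_mem hw hw1 fun ω => 𝒯.prod_mem (𝒯.bitString_mem (n + 1) (f ω)) (hQ ω))
    have h2 : assoc (classical 2) (bitReg n) X (∑ ω, w ω • prodVec (S ω) (Q ω))
        = ∑ ω, w ω • prodVec (delta (f ω 0)) (prodVec (bitString n (Fin.tail (f ω))) (Q ω)) := by
      rw [map_sum]
      refine Finset.sum_congr rfl fun ω _ => ?_
      rw [map_smul]
      exact congrArg _ (assoc_prodVec _ _ _)
    rw [h2] at h1
    -- Chain rule: the first bit, given the other bits and `X`, has no more entropy than given `X`
    -- alone.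
    have h3 := ent_mix_sub_le_of_trans hC hD hw hw1
      (P := fun ω => delta (f ω 0)) (Q := fun ω => prodVec (bitString n (Fin.tail (f ω))) (Q ω))
      (fun ω => 𝒯.delta_mem _) (fun ω => 𝒯.prod_mem (𝒯.bitString_mem _ _) (hQ ω))
      (𝒯.removeFst_mem (bitReg n) X)
    have h4 (ω : Ω) : removeFst (bitReg n) X (prodVec (bitString n (Fin.tail (f ω))) (Q ω)) = Q ω :=
      removeFst_prodVec _ (𝒯.normalised (𝒯.bitString_mem n _) _)
    simp only [h4] at h3
    have h5 := ih fun ω => Fin.tail (f ω)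
    rw [Fin.sum_univ_succ]
    change H.ent (comp (comp (classical 2) (bitReg n)) X) (∑ ω, w ω • prodVec (S ω) (Q ω)) - _ ≤
      _ + ∑ i : Fin n, (H.ent (comp (classical 2) X)
        (∑ ω, w ω • prodVec (delta (Fin.tail (f ω) i)) (Q ω)) - H.ent X (∑ ω, w ω • Q ω))
    linarith

/-- A classical system produced from classical data by a noisy channel has, given a system produced
from the same data, at least the entropy of the noise. -/
theorem add_ent_le_ent_mix (hC : H.COND) (hS : H.SHAN) (hD : H.DPI) {d d' : ℕ} {p : Fin d → ℝ}
    (hp : ∀ y, 0 ≤ p y) (hp1 : ∑ y, p y = 1) {W : Fin d → Vec (classical d' : Sys σ)}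
    (hW : ∀ y, W y ∈ 𝒯.states (classical d')) {c : ℝ} (hc : ∀ y, c ≤ shannon (W y ()))
    {C : Sys σ} {Q : Fin d → Vec C} (hQ : ∀ y, Q y ∈ 𝒯.states C) :
    c + H.ent C (∑ y, p y • Q y)
      ≤ H.ent (comp (classical d') C) (∑ y, p y • prodVec (W y) (Q y)) := by
  -- DPI is applied to a classical copy of `y` that gets processed into `C`. The conditional entropy
  -- before processing is purely classical, hence bounded below by `c` through the Shannon chain
  -- rule.
  have h := ent_mix_sub_le_of_trans hC hD hp hp1 (P := W)
    (Q := (delta : Fin d → Vec (classical d : Sys σ))) hW (fun y => 𝒯.delta_mem y)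
    (𝒯.condPrep_mem hQ)
  have h1 (y : Fin d) : condPrep Q (delta y) = Q y := condPrep_delta Q y
  simp only [h1] at h
  have h2 := hS (classical d) trivial _ (𝒯.mix_mem hp hp1 fun y => 𝒯.delta_mem y)
  have h3 := hS (comp (classical d') (classical d)) ⟨trivial, trivial⟩ _
    (𝒯.mix_mem hp hp1 fun y => 𝒯.prod_mem (hW y) (𝒯.delta_mem y))
  have h4 : (∑ y, p y • (delta y : Vec (classical d : Sys σ))) (meas0 (classical d)) = p := by
    funext y
    simp [Finset.sum_apply, delta]
  have h5 : (∑ y, p y • prodVec (W y) (delta y : Vec (classical d : Sys σ)))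
      (meas0 (comp (classical d') (classical d)))
      = fun zy : Fin d' × Fin d => p zy.2 * W zy.2 () zy.1 := by
    funext zy
    simp [Finset.sum_apply, delta, prodVec]
  rw [h4] at h2
  rw [h5] at h3
  have h6 := add_shannon_le_shannon_mul hp hp1 (fun y => 𝒯.normalised (hW y) ()) hc
  have h7 : H.ent (comp (classical d') (classical d))
      (∑ y, p y • prodVec (W y) (delta y : Vec (classical d : Sys σ)))
      = shannon fun zy : Fin d' × Fin d => p zy.2 * W zy.2 () zy.1 := h3
  have h8 : H.ent (classical d) (∑ y, p y • (delta y : Vec (classical d : Sys σ)))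
    = shannon p := h2
  linarith

/-- Conditioning on the classical part makes any such state an ensemble of products, so the previous
bound applies without assuming how the state arose. -/
theorem add_ent_removeSnd_le (hC : H.COND) (hS : H.SHAN) (hD : H.DPI) {d d' : ℕ}
    {W : Fin d → Vec (classical d' : Sys σ)}
    (hW : ∀ y, W y ∈ 𝒯.states (classical d')) {c : ℝ} (hc : ∀ y, c ≤ shannon (W y ()))
    {C : Sys σ} {P : Vec (comp C (classical d))} (hP : P ∈ 𝒯.states (comp C (classical d))) :
    c + H.ent C (removeSnd C (classical d) P)
      ≤ H.ent (comp C (classical d')) (onSnd C (condPrep W) P) := by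
  have hm := 𝒯.map_mem (𝒯.onSnd_mem C (𝒯.condPrep_mem hW)) hP
  obtain ⟨p, Q, hp, hp1, hQ, rfl⟩ := Theory.exists_eq_sum_prodVec_delta hP
  rw [← H.ent_swap _ _ _ hm, onSnd_mix, map_sum, map_sum]
  have h := add_ent_le_ent_mix hC hS hD hp hp1 hW hc hQ
  have h1 (y : Fin d) : swap C (classical d') (p y • prodVec (Q y) (condPrep W (delta y)))
      = p y • prodVec (W y) (Q y) := by
    rw [map_smul, swap_prodVec]
    exact congrArg (fun z => p y • prodVec z (Q y)) (condPrep_delta W y)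
  have h2 (y : Fin d) : removeSnd C (classical d) (p y • prodVec (Q y) (delta y))
      = p y • Q y := by
    rw [map_smul]
    exact congrArg _ (removeSnd_prodVec _ (sum_delta y ()))
  simpa only [h1, h2] using h

end Ensembles

end EntropyMeasure

/-! ### The information causality game -/

section Game

variable {σ : Signature.{u}} {𝒯 : Theory σ} {H : EntropyMeasure 𝒯}

/-- Reordering a tripartite system, from `R(XB)` to `(BR)X`. -/
def rotate (R X B : Sys σ) : Vec (comp R (comp X B)) →ₗ[ℝ] Vec (comp (comp B R) X) :=
  swap X (comp B R) ∘ₗ assoc X B R ∘ₗ swap R (comp X B)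

theorem Theory.rotate_mem (𝒯 : Theory σ) (R X B : Sys σ) :
    rotate R X B ∈ 𝒯.trans (comp R (comp X B)) (comp (comp B R) X) :=
  𝒯.comp_mem (𝒯.comp_mem (𝒯.swap_mem _ _) (𝒯.assoc_mem _ _ _)) (𝒯.swap_mem _ _)

theorem EntropyMeasure.ent_rotate {R X B : Sys σ} {P : Vec (comp R (comp X B))}
    (hP : P ∈ 𝒯.states (comp R (comp X B))) :
    H.ent (comp (comp B R) X) (rotate R X B P) = H.ent (comp R (comp X B)) P := by
  have h1 := 𝒯.map_mem (𝒯.swap_mem _ _) hP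
  have h2 := 𝒯.map_mem (𝒯.assoc_mem _ _ _) h1
  exact (H.ent_swap _ _ _ h2).trans ((H.ent_assoc _ _ _ _ h1).trans (H.ent_swap _ _ _ hP))

/-- Rotation puts the message last, where the noise acts as a map on the second part of a bipartite
system. -/
theorem onSnd_rotate {R X X' B : Sys σ} (T : Vec X →ₗ[ℝ] Vec X') (r : Vec R)
    (Q : Vec (comp X B)) :
    onSnd (comp B R) T (rotate R X B (prodVec r Q)) = rotate R X' B (prodVec r (onFst T B Q)) := by
  funext j i
  have h : sliceSnd (rotate R X B (prodVec r Q)) j.1 i.1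
      = r j.1.2 i.1.2 • sliceFst Q j.1.1 i.1.1 := rfl
  have h1 : onSnd (comp B R) T (rotate R X B (prodVec r Q)) j i
    = T (sliceSnd (rotate R X B (prodVec r Q)) j.1 i.1) j.2 i.2 := rfl
  rw [h1, h, map_smul]
  rfl

theorem removeSnd_rotate {R X B : Sys σ} (r : Vec R) (Q : Vec (comp X B)) :
    removeSnd (comp B R) X (rotate R X B (prodVec r Q)) = prodVec (removeFst X B Q) r := by
  funext j i
  have h : removeSnd (comp B R) X (rotate R X B (prodVec r Q)) j i
    = ∑ x, r j.2 i.2 * Q (meas0 X, j.1) (x, i.1) := rfl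
  rw [h, ← Finset.mul_sum, mul_comm]
  rfl

theorem sum_smul_prodVec_bitString {B : Sys σ} (P : Vec B) (N : ℕ) :
    ∑ a, ((2 : ℝ) ^ N)⁻¹ • prodVec P (bitString N a)
      = prodVec P (fun _ _ => ((2 : ℝ) ^ N)⁻¹ : Vec (bitReg N)) := by
  funext j i
  have h := sum_bitString N j.2 i.2
  simp only [Finset.sum_apply, Pi.smul_apply, prodVec, smul_eq_mul]
  rw [← Finset.mul_sum, ← Finset.mul_sum, h]
  ring

theorem Theory.uniform_mem (𝒯 : Theory σ) (N : ℕ) :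
    (fun _ _ => ((2 : ℝ) ^ N)⁻¹ : Vec (bitReg N)) ∈ 𝒯.states (bitReg N) := by
  have h := 𝒯.mix_mem (Ω := Fin N → Fin 2) (w := fun _ => ((2 : ℝ) ^ N)⁻¹)
    (fun _ => by positivity) (by simp) (fun a => 𝒯.bitString_mem N a)
  convert h using 1
  funext j i
  simp only [Finset.sum_apply, Pi.smul_apply, smul_eq_mul]
  rw [← Finset.mul_sum, sum_bitString, mul_one]

/-- Information causality for a message of `d'` values sent through the noisy channel `W`: the
efficiency is at most the maximal entropy of the message minus the entropy of the noise. -/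
theorem sum_mutualInfo_le (hC : H.COND) (hS : H.SHAN) (hD : H.DPI) {A B : Sys σ}
    {P : Vec (comp A B)} (hP : P ∈ 𝒯.states (comp A B)) {N d d' : ℕ}
    {G : (Fin N → Fin 2) → (Vec A →ₗ[ℝ] Vec (classical d : Sys σ))}
    (hG : ∀ a, G a ∈ 𝒯.trans A (classical d))
    {W : Fin d → Vec (classical d' : Sys σ)} (hW : ∀ y, W y ∈ 𝒯.states (classical d'))
    {c : ℝ} (hc : ∀ y, c ≤ shannon (W y ()))
    {D : Fin N → (Vec (comp (classical d') B) →ₗ[ℝ] Vec (classical 2 : Sys σ))}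
    (hDt : ∀ b, D b ∈ 𝒯.trans (comp (classical d') B) (classical 2)) :
    ∑ i : Fin N, mutualInfo (fun s t : Fin 2 => ∑ a : Fin N → Fin 2, if a i = s then
      (2 ^ N : ℝ)⁻¹ * D i (onFst (condPrep W) B (onFst (G a) B P)) () t else 0)
      ≤ Real.logb 2 d' - c := by
  set w : (Fin N → Fin 2) → ℝ := fun _ => ((2 : ℝ) ^ N)⁻¹ with hw_def
  have hw (a) : 0 ≤ w a := by positivity
  have hw1 : ∑ a, w a = 1 := by simp [hw_def]
  set Q₀ := fun a => onFst (G a) B P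
  set Q := fun a => onFst (condPrep W) B (Q₀ a)
  have hWt := 𝒯.condPrep_mem hW
  have hQ₀ (a) : Q₀ a ∈ 𝒯.states (comp (classical d) B) := 𝒯.map_mem (𝒯.onFst_mem (hG a) B) hP
  have hQ (a) : Q a ∈ 𝒯.states (comp (classical d') B) := 𝒯.map_mem (𝒯.onFst_mem hWt B) (hQ₀ a)
  -- No-signalling: Bob's marginal does not depend on Alice's string.
  have hB₀ (a) : removeFst (classical d) B (Q₀ a) = removeFst A B P :=
    Theory.removeFst_onFst hP (hG a)
  have hB (a) : removeFst (classical d') B (Q a) = removeFst A B P :=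
    (Theory.removeFst_onFst (hQ₀ a) hWt).trans (hB₀ a)
  have hPB := 𝒯.map_mem (𝒯.removeFst_mem A B) hP
  have hmQ := 𝒯.mix_mem hw hw1 hQ
  have h1 := EntropyMeasure.ent_bitString_sub_le hC hD hw hw1 hQ N id
  have h2 : H.ent (comp (classical d') B) (∑ a, w a • Q a)
      ≤ Real.logb 2 d' + H.ent B (removeFst A B P) := by
    have h := EntropyMeasure.ent_le_add hC hS hD hmQ
    have hr : removeFst (classical d') B (∑ a, w a • Q a) = removeFst A B P := by
      rw [map_sum]
      simp only [map_smul, hB]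
      rw [← Finset.sum_smul, hw1, one_smul]
    have hm := 𝒯.map_mem (𝒯.remove_mem _ _) hmQ
    have h' := hS (classical d') trivial _ hm
    have h'' := shannon_le_logb_card (ι := Fin d') (𝒯.nonneg hm ()) (𝒯.normalised hm ())
    rw [Fintype.card_fin] at h''
    rw [hr] at h
    have h3 := h'.le.trans h''
    linarith
  -- The noise contributes `c`. Without the message, the string and `B` are in a product state with
  -- a uniform string, which contributes H(B) + N.
  have h3 : c + (H.ent B (removeFst A B P) + N)
      ≤ H.ent (comp (bitReg N) (comp (classical d') B))
        (∑ a, w a • prodVec (bitString N a) (Q a)) := by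
    have hm₀ := 𝒯.mix_mem hw hw1 fun a => 𝒯.prod_mem (𝒯.bitString_mem N a) (hQ₀ a)
    have hm := 𝒯.mix_mem hw hw1 fun a => 𝒯.prod_mem (𝒯.bitString_mem N a) (hQ a)
    have h := EntropyMeasure.add_ent_removeSnd_le hC hS hD hW hc
      (𝒯.map_mem (𝒯.rotate_mem _ _ _) hm₀)
    have e1 : onSnd (comp B (bitReg N)) (condPrep W) (rotate (bitReg N) (classical d) B
        (∑ a, w a • prodVec (bitString N a) (Q₀ a)))
        = rotate (bitReg N) (classical d') B (∑ a, w a • prodVec (bitString N a) (Q a)) := by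
      rw [map_sum, map_sum, map_sum]
      refine Finset.sum_congr rfl fun a _ => ?_
      rw [map_smul, map_smul, map_smul]
      exact congrArg _ (onSnd_rotate _ _ _)
    have e2 : removeSnd (comp B (bitReg N)) (classical d) (rotate (bitReg N) (classical d) B
        (∑ a, w a • prodVec (bitString N a) (Q₀ a)))
        = prodVec (removeFst A B P) (fun _ _ => ((2 : ℝ) ^ N)⁻¹ : Vec (bitReg N)) := by
      rw [map_sum, map_sum, ← sum_smul_prodVec_bitString]
      refine Finset.sum_congr rfl fun a _ => ?_
      rw [map_smul, map_smul, ← hB₀ a]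
      exact congrArg _ (removeSnd_rotate _ _)
    rw [e1, e2, EntropyMeasure.ent_rotate hm] at h
    have h' := EntropyMeasure.add_le_ent_prodVec hC hS hD hPB (𝒯.uniform_mem N)
    rw [hS _ (isClassical_bitReg N) _ (𝒯.uniform_mem N),
      shannon_const N (card_out_bitReg N)] at h'
    linarith
  -- Bob's operation processes the message and `B` into β, so H(a_i|X) ≤ H(a_i|β); moreover H(a_i) ≤
  -- 1.
  have h4 (i : Fin N) : mutualInfo (fun s t : Fin 2 => ∑ a : Fin N → Fin 2, if a i = s then
      (2 ^ N : ℝ)⁻¹ * D i (Q a) () t else 0) ≤ 1 -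
      (H.ent (comp (classical 2) (comp (classical d') B)) (∑ a, w a • prodVec (delta (id a i)) (Q a))
        - H.ent (comp (classical d') B) (∑ a, w a • Q a)) := by
    have hDQ (a) := 𝒯.map_mem (hDt i) (hQ a)
    have h := EntropyMeasure.ent_mix_sub_le_of_trans hC hD hw hw1
      (fun a => 𝒯.delta_mem (a i)) hQ (hDt i)
    have hm := 𝒯.mix_mem hw hw1 hDQ
    have hm' := 𝒯.mix_mem hw hw1 fun a => 𝒯.prod_mem (𝒯.delta_mem (a i)) (hDQ a)
    have e1 : H.ent (classical 2) (∑ a, w a • D i (Q a))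
        = shannon ((∑ a, w a • D i (Q a)) ()) := hS (classical 2) trivial _ hm
    have e2 : H.ent (comp (classical 2) (classical 2))
        (∑ a, w a • prodVec (delta (a i)) (D i (Q a)))
        = shannon (fun st : Fin 2 × Fin 2 =>
          (∑ a, w a • prodVec (delta (a i)) (D i (Q a))) ((), ()) st) :=
      hS (comp (classical 2) (classical 2)) ⟨trivial, trivial⟩ _ hm'
    have q1 : (fun t : Fin 2 => ∑ s : Fin 2, ∑ a : Fin N → Fin 2, if a i = s then
        (2 ^ N : ℝ)⁻¹ * D i (Q a) () t else 0) = (∑ a, w a • D i (Q a)) () := by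
      funext t
      rw [Finset.sum_comm]
      simp [Finset.sum_apply, hw_def]
    have q2 : (fun st : Fin 2 × Fin 2 => ∑ a : Fin N → Fin 2, if a i = st.1 then
        (2 ^ N : ℝ)⁻¹ * D i (Q a) () st.2 else 0) = fun st : Fin 2 × Fin 2 =>
          (∑ a, w a • prodVec (delta (a i)) (D i (Q a))) ((), ()) st := by
      funext st
      simp [Finset.sum_apply, hw_def, prodVec, delta, eq_comm]
    have q3 : shannon (fun s : Fin 2 => ∑ t : Fin 2, ∑ a : Fin N → Fin 2, if a i = s then
        (2 ^ N : ℝ)⁻¹ * D i (Q a) () t else 0) ≤ 1 := by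
      refine (shannon_le_logb_card (fun s => ?_) ?_).trans (by simp)
      · refine Finset.sum_nonneg fun t _ => Finset.sum_nonneg fun a _ => ?_
        split_ifs
        · exact mul_nonneg (hw a) (𝒯.nonneg (hDQ a) () t)
        · exact le_rfl
      · rw [Finset.sum_comm]
        refine Eq.trans (Finset.sum_congr rfl fun t _ => congrFun q1 t) ?_
        exact 𝒯.normalised hm ()
    unfold mutualInfo
    rw [q1, q2, ← e1, ← e2]
    simp only [id]
    linarith
  refine (Finset.sum_le_sum fun i _ => h4 i).trans ?_
  rw [Finset.sum_sub_distrib]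
  simp only [Finset.sum_const, Finset.card_univ, Fintype.card_fin, nsmul_eq_mul, mul_one]
  simp only [id] at h1 ⊢
  linarith

theorem shannon_delta {d : ℕ} (y : Fin d) :
    shannon ((delta y : Vec (classical d : Sys σ)) ()) = 0 := by
  simp [shannon, delta]

theorem informationCausality (hC : H.COND) (hS : H.SHAN) (hD : H.DPI) :
    𝒯.InformationCausality := by
  intro A B P N m E D hP hE hDt
  have h := sum_mutualInfo_le hC hS hD hP hE (fun y => 𝒯.delta_mem y)
    (c := 0) (fun y => (shannon_delta y).ge) hDt
  rw [condPrep_delta_eq_id, Nat.cast_pow, Real.logb_pow, Nat.cast_ofNat,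
    Real.logb_self_eq_one one_lt_two, mul_one, sub_zero] at h
  exact h

end Game

/-! ### Estimates for the information in a biased bit -/

section Analysis

/-- The relative entropy, in nats, of a bit with bias `y` to an unbiased bit. -/
noncomputable def biasInfo (y : ℝ) : ℝ :=
  (1 + y) / 2 * Real.log (1 + y) + (1 - y) / 2 * Real.log (1 - y)

theorem abs_biasInfo_sub_le {y : ℝ} (hy : |y| ≤ 1 / 2) : |biasInfo y - y ^ 2 / 2| ≤ 2 * |y| ^ 3 := by
  have bound {x : ℝ} (hx : |x| ≤ 1 / 2) : |Real.log (1 - x) + x + x ^ 2 / 2| ≤ 2 * |x| ^ 3 := by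
    have h := Real.abs_log_sub_add_sum_range_le (x := x) (by linarith) 2
    have h' : |x| ^ (2 + 1) / (1 - |x|) ≤ 2 * |x| ^ 3 := by
      rw [div_le_iff₀ (by linarith), show 2 + 1 = 3 from rfl]
      have : 0 ≤ |x| ^ 3 := by positivity
      nlinarith
    refine le_trans (le_of_eq ?_) (h.trans h')
    congr 1
    simp [Finset.sum_range_succ]
    ring
  have h1 := bound hy
  have h2 := bound (x := -y) (by rwa [abs_neg])
  rw [abs_neg] at h2
  obtain ⟨hl, hu⟩ := abs_le.1 hy
  set r := |y| ^ 3
  rw [abs_le] at h1 h2 ⊢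
  rw [show 1 - -y = 1 + y by ring] at h2
  -- The second-order Taylor polynomials of the logarithms contribute exactly `y ^ 2 / 2`. What is
  -- left is a convex combination of the two remainders.
  have e : biasInfo y - y ^ 2 / 2 = (1 + y) / 2 * (Real.log (1 + y) + -y + (-y) ^ 2 / 2)
      + (1 - y) / 2 * (Real.log (1 - y) + y + y ^ 2 / 2) := by
    unfold biasInfo; ring
  rw [e]
  generalize Real.log (1 + y) + -y + (-y) ^ 2 / 2 = u at *
  generalize Real.log (1 - y) + y + y ^ 2 / 2 = v at *
  constructor <;> nlinarith

/-- If the first of two bits is unbiased, the mutual information is at least the information in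
their parity. -/
theorem biasInfo_le_mutualInfo {q : Fin 2 → Fin 2 → ℝ} (h0 : ∀ s t, 0 ≤ q s t)
    (h1 : ∀ s, ∑ t, q s t = 1 / 2) (hy : |q 0 0 + q 1 1 - q 0 1 - q 1 0| < 1) :
    biasInfo (q 0 0 + q 1 1 - q 0 1 - q 1 0) ≤ mutualInfo q * Real.log 2 := by
  set y := q 0 0 + q 1 1 - q 0 1 - q 1 0 with hy_def
  obtain ⟨hl, hu⟩ := abs_lt.1 hy
  -- A term of Gibbs' inequality, comparing `q s t` with `m t * (1 ± y) / 2`, where `m` is the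
  -- marginal of the second bit and the sign is that of the parity. The comparison weights sum to
  -- one, so the four left sides below add up to zero.
  have key {x m g : ℝ} (hx : 0 ≤ x) (hxm : x ≤ m) (hg : 0 < g) :
      x - m * g / 2 ≤ x * Real.log x - x * Real.log m + x * Real.log 2 - x * Real.log g := by
    rcases hx.eq_or_lt with h | h
    · rw [← h]
      have : 0 ≤ m * g := mul_nonneg (hx.trans hxm) hg.le
      simp only [zero_mul]; linarith
    · have hm : 0 < m := h.trans_le hxm
      have hl := Real.one_sub_inv_le_log_of_pos (show 0 < x * 2 / (m * g) by positivity)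
      rw [Real.log_div (by positivity) (by positivity), Real.log_mul h.ne' two_ne_zero,
        Real.log_mul hm.ne' hg.ne', inv_div] at hl
      have := mul_le_mul_of_nonneg_left hl hx
      have e : x * (1 - m * g / (x * 2)) = x - m * g / 2 := by field_simp
      rw [e] at this
      linarith
  have a0 := h1 0
  have a1 := h1 1
  rw [Fin.sum_univ_two] at a0 a1
  have k00 := key (h0 0 0) (le_add_of_nonneg_right (h0 1 0)) (show 0 < 1 + y by linarith)
  have k10 := key (h0 1 0) (le_add_of_nonneg_left (h0 0 0)) (show 0 < 1 - y by linarith)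
  have k01 := key (h0 0 1) (le_add_of_nonneg_right (h0 1 1)) (show 0 < 1 - y by linarith)
  have k11 := key (h0 1 1) (le_add_of_nonneg_left (h0 0 1)) (show 0 < 1 + y by linarith)
  have hl2 : Real.log 2 ≠ 0 := (Real.log_pos one_lt_two).ne'
  have e : mutualInfo q * Real.log 2 = Real.log 2
      - ((q 0 0 + q 1 0) * Real.log (q 0 0 + q 1 0) + (q 0 1 + q 1 1) * Real.log (q 0 1 + q 1 1))
      + (q 0 0 * Real.log (q 0 0) + q 0 1 * Real.log (q 0 1) + q 1 0 * Real.log (q 1 0)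
        + q 1 1 * Real.log (q 1 1)) := by
    simp only [mutualInfo, shannon, Fintype.sum_prod_type, h1]
    simp only [Fin.sum_univ_two, Real.logb, one_div, Real.log_inv]
    field_simp
    ring
  have e2 : biasInfo y = (q 0 0 + q 1 1) * Real.log (1 + y) + (q 0 1 + q 1 0) * Real.log (1 - y) := by
    unfold biasInfo
    rw [show (1 + y) / 2 = q 0 0 + q 1 1 by linarith, show (1 - y) / 2 = q 0 1 + q 1 0 by linarith]
  have e3 : Real.log 2 = (q 0 0 + q 0 1 + q 1 0 + q 1 1) * Real.log 2 := by
    rw [show q 0 0 + q 0 1 + q 1 0 + q 1 1 = 1 by linarith, one_mul]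
  rw [e, e2, e3]
  nlinarith

end Analysis

/-! ### The CHSH strategy and Tsirelson's bound -/

section Tsirelson

variable {σ : Signature.{u}} {𝒯 : Theory σ} {H : EntropyMeasure 𝒯}

/-- A bit whose value is `y` with bias `ε`. -/
noncomputable def noisyBit (ε : ℝ) (y : Fin 2) : Vec (classical 2 : Sys σ) :=
  fun _ z => if z = y then (1 + ε) / 2 else (1 - ε) / 2

theorem Theory.noisyBit_mem (𝒯 : Theory σ) {ε : ℝ} (hε : |ε| ≤ 1) (y : Fin 2) :
    noisyBit ε y ∈ 𝒯.states (classical 2) := by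
  obtain ⟨hl, hu⟩ := abs_le.1 hε
  refine 𝒯.classical_states 2 _ (fun i => ?_) ?_
  · unfold noisyBit
    split_ifs <;> linarith
  · fin_cases y <;> simp [noisyBit, Fin.sum_univ_two] <;> ring

/-- This is the capacity, in nats, of the binary symmetric channel of bias `ε`. -/
theorem shannon_noisyBit {ε : ℝ} (hε : |ε| < 1) (y : Fin 2) :
    (1 - shannon ((noisyBit ε y : Vec (classical 2 : Sys σ)) ())) * Real.log 2 = biasInfo ε := by
  obtain ⟨hl, hu⟩ := abs_lt.1 hε
  have hl2 : Real.log 2 ≠ 0 := (Real.log_pos one_lt_two).ne'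
  have e1 : Real.log ((1 + ε) / 2) = Real.log (1 + ε) - Real.log 2 :=
    Real.log_div (by linarith) two_ne_zero
  have e2 : Real.log ((1 - ε) / 2) = Real.log (1 - ε) - Real.log 2 :=
    Real.log_div (by linarith) two_ne_zero
  have e : shannon ((noisyBit ε y : Vec (classical 2 : Sys σ)) ())
      = -((1 + ε) / 2 * Real.logb 2 ((1 + ε) / 2) + (1 - ε) / 2 * Real.logb 2 ((1 - ε) / 2)) := by
    unfold shannon
    congr 1
    refine (Fin.sum_univ_two _).trans ?_
    fin_cases y <;> simp [noisyBit]
    ring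
  rw [e, Real.logb, Real.logb, e1, e2, biasInfo]
  field_simp
  ring

/-- Adding `x` modulo two to a bit. -/
def flip (x : Fin 2) : Vec (classical 2 : Sys σ) →ₗ[ℝ] Vec (classical 2 : Sys σ) :=
  condPrep fun y => delta (y + x)

theorem flip_apply (x : Fin 2) (P : Vec (classical 2 : Sys σ)) (t : Fin 2) :
    flip x P () t = P () (t + x) := by
  unfold flip
  rw [condPrep_apply, Finset.sum_apply, Finset.sum_apply]
  refine (Fin.sum_univ_two _).trans ?_
  fin_cases x <;> fin_cases t <;> simp [delta]

instance instFiniteMeas : (A : Sys σ) → Finite (Meas A)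
  | classical _ => inferInstanceAs (Finite Unit)
  | elem e => inferInstanceAs (Finite (Fin (σ.k e)))
  | comp A B =>
    haveI := instFiniteMeas A
    haveI := instFiniteMeas B
    inferInstanceAs (Finite (Meas A × Meas B))

open Classical in
theorem exists_linear_eq_sum {A B : Sys σ} [Fintype (Meas A)] (T : Vec A →ₗ[ℝ] Vec B) :
    ∃ c : Meas A → Out A → Vec B, ∀ P, T P = ∑ j, ∑ i, P j i • c j i := by
  refine ⟨fun j i => T (Pi.single j (Pi.single i 1)), fun P => ?_⟩
  have h : P = ∑ j, ∑ i, P j i • (Pi.single j (Pi.single i 1) : Vec A) := by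
    funext j i
    simp only [Finset.sum_apply, Pi.smul_apply]
    rw [Finset.sum_eq_single j, Finset.sum_eq_single i]
    · simp
    · intro i' _ hi
      simp [Pi.single_eq_of_ne hi.symm]
    · simp
    · intro j' _ hj
      simp [Pi.single_eq_of_ne hj.symm]
    · simp
  conv_lhs => rw [h]
  rw [map_sum]
  refine Finset.sum_congr rfl fun j _ => ?_
  rw [map_sum]
  refine Finset.sum_congr rfl fun i _ => ?_
  rw [map_smul]

/-- Local maps on the two parts of a composite system commute. -/
theorem onFst_onSnd {A A' B B' : Sys σ} (T : Vec A →ₗ[ℝ] Vec A') (U : Vec B →ₗ[ℝ] Vec B')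
    (P : Vec (comp A B)) : onFst T B' (onSnd A U P) = onSnd A' U (onFst T B P) := by
  have := Fintype.ofFinite (Meas A)
  -- Expanding `T` alone in coordinates is enough: linearity of `U` does the rest.
  obtain ⟨c, hc⟩ := exists_linear_eq_sum T
  funext j i
  have h : sliceSnd (onFst T B P) j.1 i.1 = ∑ k, ∑ l, c k l j.1 i.1 • sliceSnd P k l := by
    funext j' i'
    have h' : sliceSnd (onFst T B P) j.1 i.1 j' i' = T (sliceFst P j' i') j.1 i.1 := rfl
    rw [h', hc]
    simp [Finset.sum_apply, sliceSnd, sliceFst, mul_comm]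
  have h1 : onSnd A' U (onFst T B P) j i = U (sliceSnd (onFst T B P) j.1 i.1) j.2 i.2 := rfl
  have h2 : onFst T B' (onSnd A U P) j i = T (sliceFst (onSnd A U P) j.2 i.2) j.1 i.1 := rfl
  rw [h1, h2, h, hc]
  simp only [map_sum, map_smul]
  simp [Finset.sum_apply, onSnd, sliceFst, mul_comm]

variable {A B : Sys σ}

/-- Alice's measurement in the game with two bits: she measures `a₀ + a₁` and adds `a₀` to the
outcome. -/
def encode (M : Fin 2 → (Vec A →ₗ[ℝ] Vec (classical 2 : Sys σ))) (a : Fin 2 → Fin 2) :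
    Vec A →ₗ[ℝ] Vec (classical 2 : Sys σ) :=
  flip (a 0) ∘ₗ M (a 0 + a 1)

/-- Bob's guess: he measures `b` and adds the message to the outcome. -/
def decode (L : Fin 2 → (Vec B →ₗ[ℝ] Vec (classical 2 : Sys σ))) (b : Fin 2) :
    Vec (comp (classical 2) B) →ₗ[ℝ] Vec (classical 2 : Sys σ) :=
  removeFst (classical 2) (classical 2) ∘ₗ control fun x => flip x ∘ₗ L b

/-- Addition modulo two is its own inverse: the message `y` comes from Alice's outcome `y + a 0`,
and the guess `t` after receiving `x` from Bob's outcome `t + x`. -/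
theorem decode_encode_apply (P : Vec (comp A B))
    (M : Fin 2 → (Vec A →ₗ[ℝ] Vec (classical 2 : Sys σ)))
    (L : Fin 2 → (Vec B →ₗ[ℝ] Vec (classical 2 : Sys σ)))
    (W : Fin 2 → Vec (classical 2 : Sys σ)) (a : Fin 2 → Fin 2) (b t : Fin 2) :
    decode L b (onFst (condPrep W) B (onFst (encode M a) B P)) () t
      = ∑ x, ∑ y, outcomeProb P M L (a 0 + a 1) b (y + a 0) (t + x) * W y () x := by
  set Z := onFst (condPrep W) B (onFst (encode M a) B P)
  have h1 : decode L b Z () t = ∑ x : Fin 2, flip x (L b (sliceSnd Z () x)) () t := rfl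
  rw [h1]
  refine Finset.sum_congr rfl fun x _ => ?_
  rw [flip_apply]
  have h2 : L b (sliceSnd Z () x) () (t + x)
      = onSnd (classical 2) (L b) (onFst (condPrep W ∘ₗ encode M a) B P) ((), ()) (x, t + x) := rfl
  rw [h2, ← onFst_onSnd]
  have h3 : onFst (condPrep W ∘ₗ encode M a) (classical 2) (onSnd A (L b) P) ((), ()) (x, t + x)
    = condPrep W (flip (a 0) (M (a 0 + a 1) (sliceFst (onSnd A (L b) P) () (t + x)))) () x := rfl
  rw [h3, condPrep_apply, Finset.sum_apply, Finset.sum_apply]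
  refine Finset.sum_congr rfl fun y _ => ?_
  have h4 : (flip (a 0) (M (a 0 + a 1) (sliceFst (onSnd A (L b) P) () (t + x))) () y • W y) () x
    = flip (a 0) (M (a 0 + a 1) (sliceFst (onSnd A (L b) P) () (t + x))) () y * W y () x := rfl
  rw [h4, flip_apply]
  rfl

theorem sum_pair_bits (F : (Fin 2 → Fin 2) → ℝ) :
    ∑ a, F a = F ![0, 0] + F ![0, 1] + F ![1, 0] + F ![1, 1] := by
  rw [← (finTwoArrowEquiv (Fin 2)).symm.sum_comp, Fintype.sum_prod_type]
  simp [Fin.sum_univ_two, finTwoArrowEquiv, add_assoc]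

/-- The correlator of the outcomes of a pair of measurements. -/
def correlator (p : Fin 2 → Fin 2 → Fin 2 → Fin 2 → ℝ) (x y : Fin 2) : ℝ :=
  p x y 0 0 + p x y 1 1 - p x y 0 1 - p x y 1 0

/-- The bias of Bob's guess of the bit `b`, for a noiseless message. -/
noncomputable def guessBias (p : Fin 2 → Fin 2 → Fin 2 → Fin 2 → ℝ) (b : Fin 2) : ℝ :=
  if b = 0 then (correlator p 0 0 + correlator p 1 0) / 2
  else (correlator p 0 1 - correlator p 1 1) / 2

/-- Without noise, Bob's guess is `a 0` plus the two outcomes. It equals `a b` exactly when the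
outcomes add up to `(a 0 + a 1) * b` modulo two, which is the CHSH condition for the inputs `a 0 + a
1` and `b`. -/
theorem tsirelsonBound (hC : H.COND) (hS : H.SHAN) (hD : H.DPI) : 𝒯.TsirelsonBound := by
  intro A B P M L hP hM hL
  set p := outcomeProb P M L with hp_def
  have hmem (x y) : onFst (M x) (classical 2) (onSnd A (L y) P)
      ∈ 𝒯.states (comp (classical 2) (classical 2)) :=
    𝒯.map_mem (𝒯.onFst_mem (hM x) _) (𝒯.map_mem (𝒯.onSnd_mem A (hL y)) hP)
  have hp0 (x y a b) : 0 ≤ p x y a b := 𝒯.nonneg (hmem x y) ((), ()) (a, b)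
  have hp1 (x y) : p x y 0 0 + p x y 0 1 + (p x y 1 0 + p x y 1 1) = 1 := by
    have h := 𝒯.normalised (hmem x y) ((), ())
    rw [sum_out_comp] at h
    rw [← h]
    refine Eq.symm ((Fin.sum_univ_two _).trans ?_)
    exact congrArg₂ (· + ·) (Fin.sum_univ_two _) (Fin.sum_univ_two _)
  have hflip (x : Fin 2) : flip x ∈ 𝒯.trans (classical 2) (classical 2) :=
    𝒯.condPrep_mem fun y => 𝒯.delta_mem _
  have hEt (a) : encode M a ∈ 𝒯.trans A (classical 2) := 𝒯.comp_mem (hM _) (hflip _)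
  have hDt (b) : decode L b ∈ 𝒯.trans (comp (classical 2) B) (classical 2) :=
    𝒯.comp_mem (𝒯.control_mem fun x => 𝒯.comp_mem (hL b) (hflip x)) (𝒯.removeFst_mem _ _)
  have hcor (x y) : |correlator p x y| ≤ 1 := by
    have := hp1 x y
    rw [abs_le]
    constructor <;> unfold correlator <;>
      linarith [hp0 x y 0 0, hp0 x y 0 1, hp0 x y 1 0, hp0 x y 1 1]
  have hbias (b) : |guessBias p b| ≤ 1 := by
    have h00 := abs_le.1 (hcor 0 0)
    have h10 := abs_le.1 (hcor 1 0)
    have h01 := abs_le.1 (hcor 0 1)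
    have h11 := abs_le.1 (hcor 1 1)
    rw [abs_le]
    unfold guessBias
    split_ifs <;> constructor <;> linarith
  -- The cubic errors are 2ε³ for each of the two guesses and 2ε³ for the channel; dividing their
  -- total 6ε³ by ε²/2 gives 12ε.
  have main {ε : ℝ} (hε : 0 < ε) (hε' : ε ≤ 1 / 2) :
      guessBias p 0 ^ 2 + guessBias p 1 ^ 2 ≤ 1 + 12 * ε := by
    have hεa : |ε| = ε := abs_of_pos hε
    have hW (y : Fin 2) : noisyBit ε y ∈ 𝒯.states (classical 2) :=
      𝒯.noisyBit_mem (by rw [hεa]; linarith) y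
    have hl2 : 0 < Real.log 2 := Real.log_pos one_lt_two
    have hε1 : |ε| < 1 := by rw [hεa]; linarith
    have hsh (y : Fin 2) : shannon ((noisyBit ε y : Vec (classical 2 : Sys σ)) ())
        = 1 - biasInfo ε / Real.log 2 := by
      rw [← shannon_noisyBit (σ := σ) hε1 y]
      field_simp
      ring
    have h := sum_mutualInfo_le hC hS hD hP hEt hW (fun y => (hsh y).ge) hDt
    set q : Fin 2 → Fin 2 → Fin 2 → ℝ := fun i s t => ∑ a : Fin 2 → Fin 2, if a i = s then
      (2 ^ 2 : ℝ)⁻¹ * decode L i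
        (onFst (condPrep (noisyBit ε)) B (onFst (encode M a) B P)) () t else 0 with hq
    have hg (a) (i) : decode L i (onFst (condPrep (noisyBit ε)) B (onFst (encode M a) B P))
        ∈ 𝒯.states (classical 2) :=
      𝒯.map_mem (hDt i) (𝒯.map_mem (𝒯.onFst_mem (𝒯.condPrep_mem hW) B)
        (𝒯.map_mem (𝒯.onFst_mem (hEt a) B) hP))
    have hq0 (i s t) : 0 ≤ q i s t := by
      refine Finset.sum_nonneg fun a _ => ?_
      split_ifs
      · exact mul_nonneg (by positivity) (𝒯.nonneg (hg a i) () t)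
      · exact le_rfl
    have hq1 (i s) : ∑ t, q i s t = 1 / 2 := by
      have h1 (a : Fin 2 → Fin 2) : ∑ t : Fin 2, (if a i = s then (2 ^ 2 : ℝ)⁻¹ * decode L i
          (onFst (condPrep (noisyBit ε)) B (onFst (encode M a) B P)) () t else 0)
          = if a i = s then (2 ^ 2 : ℝ)⁻¹ else 0 := by
        split_ifs
        · rw [← Finset.mul_sum]
          exact (congrArg _ (𝒯.normalised (hg a i) ())).trans (mul_one _)
        · simp
      simp only [hq]
      rw [Finset.sum_comm]
      simp only [h1]
      rw [sum_pair_bits]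
      fin_cases i <;> fin_cases s <;> norm_num
    -- The channel multiplies the bias of the noiseless guess by `ε`.
    have hqb (i) : q i 0 0 + q i 1 1 - q i 0 1 - q i 1 0 = ε * guessBias p i := by
      have hdec (s t) : q i s t = ∑ a : Fin 2 → Fin 2, if a i = s then (2 ^ 2 : ℝ)⁻¹ *
          ∑ x, ∑ y, p (a 0 + a 1) i (y + a 0) (t + x) * (if x = y then (1 + ε) / 2 else (1 - ε) / 2)
          else 0 :=
        Finset.sum_congr rfl fun a _ => by rw [decode_encode_apply]; rfl
      simp only [hdec, sum_pair_bits]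
      fin_cases i
      all_goals
        simp [Fin.sum_univ_two, guessBias, correlator]
        ring
    have hyb (i) : |ε * guessBias p i| ≤ ε := by
      rw [abs_mul, hεa]
      exact mul_le_of_le_one_right hε.le (hbias i)
    have low (i) : (ε * guessBias p i) ^ 2 / 2 - 2 * ε ^ 3 ≤ mutualInfo (q i) * Real.log 2 := by
      have h1 := biasInfo_le_mutualInfo (hq0 i) (hq1 i)
        (by rw [hqb]; exact (hyb i).trans_lt (by linarith))
      rw [hqb] at h1
      have h2 := (abs_le.1 (abs_biasInfo_sub_le ((hyb i).trans hε'))).1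
      have h3 := pow_le_pow_left₀ (abs_nonneg _) (hyb i) 3
      linarith
    have up : biasInfo ε ≤ ε ^ 2 / 2 + 2 * ε ^ 3 := by
      have h2 := (abs_le.1 (abs_biasInfo_sub_le (hεa.le.trans hε'))).2
      rw [hεa] at h2
      linarith
    have h' : mutualInfo (q 0) + mutualInfo (q 1) ≤ biasInfo ε / Real.log 2 := by
      have hsum : ∑ i, mutualInfo (q i) ≤ Real.logb 2 (2 : ℕ) - (1 - biasInfo ε / Real.log 2) := h
      rw [Fin.sum_univ_two, Nat.cast_ofNat, Real.logb_self_eq_one one_lt_two] at hsum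
      linarith
    rw [le_div_iff₀ hl2] at h'
    have h3 : ε ^ 2 * (guessBias p 0 ^ 2 + guessBias p 1 ^ 2) ≤ ε ^ 2 * (1 + 12 * ε) := by
      linarith [low 0, low 1]
    exact le_of_mul_le_mul_left h3 (by positivity)
  have hone : guessBias p 0 ^ 2 + guessBias p 1 ^ 2 ≤ 1 := by
    refine le_of_forall_pos_le_add fun δ hδ => ?_
    have h := main (ε := min (1 / 2) (δ / 12)) (lt_min (by norm_num) (by positivity))
      (min_le_left _ _)
    linarith [min_le_right (1 / 2) (δ / 12)]
  have hch : chsh P M L = 2 + (guessBias p 0 + guessBias p 1) := by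
    have e : chsh P M L = (p 0 0 0 0 + p 0 0 1 1) + (p 0 1 0 0 + p 0 1 1 1)
        + (p 1 0 0 0 + p 1 0 1 1) + (p 1 1 0 1 + p 1 1 1 0) := by
      simp only [chsh, Fin.sum_univ_two, ← hp_def]
    rw [e]
    simp only [guessBias, correlator, if_true, one_ne_zero, if_false]
    linarith [hp1 0 0, hp1 0 1, hp1 1 0, hp1 1 1]
  -- (E_0 + E_1)² ≤ 2 (E_0² + E_1²) ≤ 2; the absolute value yields both sides of the bound.
  have habs : |guessBias p 0 + guessBias p 1| ≤ √2 := by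
    refine Real.abs_le_sqrt ?_
    nlinarith [sq_nonneg (guessBias p 0 - guessBias p 1)]
  rw [hch]
  constructor <;> linarith [(abs_le.1 habs).1, (abs_le.1 habs).2]

end Tsirelson

end GPT

theorem theorem2 {σ : GPT.Signature.{u}} (𝒯 : GPT.Theory σ) (H : GPT.EntropyMeasure 𝒯)
    (hCOND : H.COND) (hSHAN : H.SHAN) (hDPI : H.DPI) :
    𝒯.InformationCausality ∧ 𝒯.TsirelsonBound :=
  ⟨GPT.informationCausality hCOND hSHAN hDPI, GPT.tsirelsonBound hCOND hSHAN hDPI⟩
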